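/- Let $R$ be a commutative noetherian local ring with maximal ideal $\mathfrak m$, residue field $k=R/\mathfrak m$ and Krull dimension $d$. For finitely generated $R$-modules $M,N$ let $\underline{\operatorname{Hom}}_R(M,N)$ be the quotient of $\operatorname{Hom}_R(M,N)$ by the submodule of homomorphisms that factor through a projective module, and let $\Omega M$ be the syzygy of $M$, that is, the kernel of a surjection from a finitely generated projective module onto $M$; lifting homomorphisms along such surjections gives maps $\Omega:\underline{\operatorname{Hom}}_R(M,N)\to\underline{\operatorname{Hom}}_R(\Omega M,\Omega N)$. For $i\ge 0$ let $V_i(M)$ be the kernel of the composition $$\operatorname{Hom}_R(M,k)\to\underline{\operatorname{Hom}}_R(M,k)\xrightarrow{\ \Omega^i\ }\underline{\operatorname{Hom}}_R(\Omega^iM,\Omega^ik),$$ and put $\xi_R(i,M)=\dim_kV_i(M)$ and $\xi_R(M)=\dim_k\bigcup_{i\ge0}V_i(M)$. Then there is an integer $n>0$ with $\xi_R(d,R/\mathfrak m^n)\ne0$. In particular, there is an integer $n>0$ with $\xi_R(R/\mathfrak m^n)\neq 0$, so the index attached to the $\xi$-invariant, $\inf\{n\ge 0 : \xi_R(R/\mathfrak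 m^n)\ne 0\}$, is well defined. -/

import Mathlib

namespace StableModule

universe u

section StableHom

variable (R : Type u) [CommRing R]
variable (M N : Type u) [AddCommGroup M] [Module R M] [AddCommGroup N] [Module R N]

/-- The submodule of `Hom_R(M, N)` of the homomorphisms that factor through some projective
module. -/
def factorsProjective : Submodule R (M →ₗ[R] N) where
  carrier := {f | ∃ (P : Type u) (_ : AddCommGroup P) (_ : Module R P) (_ : Module.Projective R P)
    (a : M →ₗ[R] P) (b : P →ₗ[R] N), f = b ∘ₗ a}
  zero_mem' := ⟨M →₀ R, inferInstance, inferInstance, inferInstance, 0, 0, by simp⟩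
  add_mem' := by
    rintro _ _ ⟨P, _, _, _, a, b, rfl⟩ ⟨Q, _, _, _, c, e, rfl⟩
    refine ⟨P × Q, inferInstance, inferInstance, inferInstance, a.prod c, b.coprod e, ?_⟩
    ext x
    simp
  smul_mem' := by
    rintro r _ ⟨P, _, _, _, a, b, rfl⟩
    exact ⟨P, inferInstance, inferInstance, inferInstance, a, r • b, by ext x; simp⟩

/-- The morphisms of the stable category: `Hom_R(M, N)` modulo the homomorphisms that factor
through a projective module. -/
abbrev StableHom : Type u := (M →ₗ[R] N) ⧸ factorsProjective R M N

end StableHom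

section Syzygy

variable (R : Type u) [CommRing R]

/-- The rank of a chosen finite free module that surjects onto `M`. -/
noncomputable def coverRank (M : Type u) [AddCommGroup M] [Module R M] [Module.Finite R M] : ℕ :=
  (Module.Finite.exists_fin' R M).choose

/-- A chosen surjection from a finite free module onto `M`, the start of a projective presentation
of `M`. -/
noncomputable def cover (M : Type u) [AddCommGroup M] [Module R M] [Module.Finite R M] :
    (Fin (coverRank R M) → R) →ₗ[R] M :=
  (Module.Finite.exists_fin' R M).choose_spec.choose

variable {M N : Type u} [AddCommGroup M] [Module R M] [Module.Finite R M]
  [AddCommGroup N] [Module R N] [Module.Finite R N]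

theorem cover_surjective : Function.Surjective (cover R M) :=
  (Module.Finite.exists_fin' R M).choose_spec.choose_spec

variable (M) in
/-- The syzygy `Ω M`, the kernel of the chosen surjection from a finite free module onto `M`
(equivalently the image of the differential of a projective presentation that extends it). In the
stable category it does not depend on the choice of that surjection. -/
def Syzygy : Type u := LinearMap.ker (cover R M)

noncomputable instance : AddCommGroup (Syzygy R M) :=
  inferInstanceAs (AddCommGroup (LinearMap.ker (cover R M)))

noncomputable instance : Module R (Syzygy R M) :=
  inferInstanceAs (Module R (LinearMap.ker (cover R M)))

instance [IsNoetherianRing R] : Module.Finite R (Syzygy R M) :=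
  inferInstanceAs (Module.Finite R (LinearMap.ker (cover R M)))

variable (M) in
/-- The inclusion of `Ω M` into the chosen free module. -/
noncomputable def syzygyIncl : Syzygy R M →ₗ[R] (Fin (coverRank R M) → R) :=
  (LinearMap.ker (cover R M)).subtype

theorem cover_syzygyIncl (x : Syzygy R M) : cover R M (syzygyIncl R M x) = 0 :=
  x.2

theorem syzygyIncl_injective : Function.Injective (syzygyIncl R M) :=
  Subtype.val_injective

/-- A map into the chosen free module that is killed by the surjection onto `N` factors through
`Ω N`. -/
theorem exists_syzygyIncl_comp {L : Type u} [AddCommGroup L] [Module R L]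
    (F : L →ₗ[R] (Fin (coverRank R N) → R)) (h : ∀ x, cover R N (F x) = 0) :
    ∃ g : L →ₗ[R] Syzygy R N, syzygyIncl R N ∘ₗ g = F :=
  ⟨F.codRestrict (LinearMap.ker (cover R N)) h, rfl⟩

/-- The homomorphism `g : Ω M → Ω N` is induced by `f : M → N`: it is the restriction of a lift of
`f` to the chosen free modules. -/
def IsSyzygyMap (f : M →ₗ[R] N) (g : Syzygy R M →ₗ[R] Syzygy R N) : Prop :=
  ∃ F : (Fin (coverRank R M) → R) →ₗ[R] (Fin (coverRank R N) → R),
    cover R N ∘ₗ F = f ∘ₗ cover R M ∧ syzygyIncl R N ∘ₗ g = F ∘ₗ syzygyIncl R M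

theorem exists_isSyzygyMap (f : M →ₗ[R] N) : ∃ g, IsSyzygyMap R f g := by
  obtain ⟨F, hF⟩ := Module.projective_lifting_property (cover R N) (f ∘ₗ cover R M)
    (cover_surjective R)
  obtain ⟨g, hg⟩ := exists_syzygyIncl_comp R (F ∘ₗ syzygyIncl R M) fun x => by
    have h := LinearMap.congr_fun hF (syzygyIncl R M x)
    simp only [LinearMap.comp_apply] at h ⊢
    rw [h, cover_syzygyIncl, map_zero]
  exact ⟨g, F, hF, hg⟩

variable {R}

theorem IsSyzygyMap.add {f f' : M →ₗ[R] N} {g g' : Syzygy R M →ₗ[R] Syzygy R N}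
    (h : IsSyzygyMap R f g) (h' : IsSyzygyMap R f' g') : IsSyzygyMap R (f + f') (g + g') := by
  obtain ⟨F, hF, hg⟩ := h
  obtain ⟨F', hF', hg'⟩ := h'
  exact ⟨F + F', by rw [LinearMap.comp_add, hF, hF', LinearMap.add_comp],
    by rw [LinearMap.comp_add, hg, hg', LinearMap.add_comp]⟩

theorem IsSyzygyMap.sub {f f' : M →ₗ[R] N} {g g' : Syzygy R M →ₗ[R] Syzygy R N}
    (h : IsSyzygyMap R f g) (h' : IsSyzygyMap R f' g') : IsSyzygyMap R (f - f') (g - g') := by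
  obtain ⟨F, hF, hg⟩ := h
  obtain ⟨F', hF', hg'⟩ := h'
  exact ⟨F - F', by rw [LinearMap.comp_sub, hF, hF', LinearMap.sub_comp],
    by rw [LinearMap.comp_sub, hg, hg', LinearMap.sub_comp]⟩

theorem IsSyzygyMap.smul (r : R) {f : M →ₗ[R] N} {g : Syzygy R M →ₗ[R] Syzygy R N}
    (h : IsSyzygyMap R f g) : IsSyzygyMap R (r • f) (r • g) := by
  obtain ⟨F, hF, hg⟩ := h
  exact ⟨r • F, by rw [LinearMap.comp_smul, hF, LinearMap.smul_comp],
    by rw [LinearMap.comp_smul, hg, LinearMap.smul_comp]⟩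

/-- A homomorphism that factors through a projective module induces only homomorphisms of the
same kind on syzygies. -/
theorem IsSyzygyMap.mem_factorsProjective {f : M →ₗ[R] N} {g : Syzygy R M →ₗ[R] Syzygy R N}
    (h : IsSyzygyMap R f g) (hf : f ∈ factorsProjective R M N) :
    g ∈ factorsProjective R (Syzygy R M) (Syzygy R N) := by
  obtain ⟨F, hF, hg⟩ := h
  obtain ⟨P, _, _, _, a, b, rfl⟩ := hf
  obtain ⟨b', hb'⟩ := Module.projective_lifting_property (cover R N) b (cover_surjective R)
  obtain ⟨G, hG⟩ := exists_syzygyIncl_comp R (F - b' ∘ₗ a ∘ₗ cover R M) fun x => by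
    have h1 := LinearMap.congr_fun hF x
    have h2 := LinearMap.congr_fun hb' (a (cover R M x))
    simp only [LinearMap.comp_apply] at h1 h2
    rw [LinearMap.sub_apply, map_sub, h1]
    simp only [LinearMap.comp_apply]
    rw [h2, sub_self]
  refine ⟨_, inferInstance, inferInstance, inferInstance, syzygyIncl R M, G, ?_⟩
  refine LinearMap.ext fun x => syzygyIncl_injective R ?_
  have h1 := LinearMap.congr_fun hg x
  have h2 := LinearMap.congr_fun hG (syzygyIncl R M x)
  simp only [LinearMap.comp_apply, LinearMap.sub_apply, cover_syzygyIncl, map_zero,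
    sub_zero] at h1 h2 ⊢
  rw [h1, h2]

/-- Two homomorphisms induced by the same `f` on syzygies agree in the stable category. -/
theorem IsSyzygyMap.mk_eq {f : M →ₗ[R] N} {g g' : Syzygy R M →ₗ[R] Syzygy R N}
    (h : IsSyzygyMap R f g) (h' : IsSyzygyMap R f g') :
    (factorsProjective R (Syzygy R M) (Syzygy R N)).mkQ g =
      (factorsProjective R (Syzygy R M) (Syzygy R N)).mkQ g' := by
  refine (Submodule.Quotient.eq _).2 ((h.sub h').mem_factorsProjective ?_)
  rw [sub_self]
  exact Submodule.zero_mem _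

variable (R M N)

/-- The map `Hom_R(M, N) → \underline{Hom}_R(Ω M, Ω N)` that sends `f` to the class of any
homomorphism of syzygies induced by `f`. -/
noncomputable def syzygyHom : (M →ₗ[R] N) →ₗ[R] StableHom R (Syzygy R M) (Syzygy R N) where
  toFun f := (factorsProjective R (Syzygy R M) (Syzygy R N)).mkQ (exists_isSyzygyMap R f).choose
  map_add' f f' :=
    ((exists_isSyzygyMap R (f + f')).choose_spec.mk_eq
      ((exists_isSyzygyMap R f).choose_spec.add (exists_isSyzygyMap R f').choose_spec)).trans
      (map_add _ _ _)
  map_smul' r f :=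
    ((exists_isSyzygyMap R (r • f)).choose_spec.mk_eq
      ((exists_isSyzygyMap R f).choose_spec.smul r)).trans (map_smul _ _ _)

/-- The syzygy functor `Ω` on morphisms of the stable category. -/
noncomputable def stableSyzygy :
    StableHom R M N →ₗ[R] StableHom R (Syzygy R M) (Syzygy R N) :=
  (factorsProjective R M N).liftQ (syzygyHom R M N) fun f hf => by
    rw [LinearMap.mem_ker]
    exact (Submodule.Quotient.mk_eq_zero (factorsProjective R (Syzygy R M) (Syzygy R N))).2
      ((exists_isSyzygyMap R f).choose_spec.mem_factorsProjective hf)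

end Syzygy

section Iterate

variable (R : Type u) [CommRing R] [IsNoetherianRing R]

/-- The iterated syzygy `Ω^n M = Ω (Ω^(n-1) M)`, as a finitely generated module. -/
noncomputable def iterSyzygy : ℕ → FGModuleCat.{u} R → FGModuleCat.{u} R
  | 0, M => M
  | n + 1, M => FGModuleCat.of R (Syzygy R (iterSyzygy n M))

/-- The map `Ω^n : \underline{Hom}_R(M, N) → \underline{Hom}_R(Ω^n M, Ω^n N)`. -/
noncomputable def iterStableSyzygy (M N : FGModuleCat.{u} R) : (n : ℕ) →
    StableHom R M N →ₗ[R] StableHom R (iterSyzygy R n M) (iterSyzygy R n N)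
  | 0 => LinearMap.id
  | n + 1 => stableSyzygy R (iterSyzygy R n M) (iterSyzygy R n N) ∘ₗ iterStableSyzygy M N n

variable (M N : Type u) [AddCommGroup M] [Module R M] [Module.Finite R M]
  [AddCommGroup N] [Module R N] [Module.Finite R N]

/-- `V_n(M, N)`, the kernel of
`Hom_R(M, N) → \underline{Hom}_R(M, N) → \underline{Hom}_R(Ω^n M, Ω^n N)`. -/
noncomputable def V (n : ℕ) : Submodule R (M →ₗ[R] N) :=
  LinearMap.ker (iterStableSyzygy R (FGModuleCat.of R M) (FGModuleCat.of R N) n ∘ₗ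
    (factorsProjective R M N).mkQ)

theorem V_mono : Monotone (V R M N) := by
  refine monotone_nat_of_le_succ fun n f hf => ?_
  have h : iterStableSyzygy R (FGModuleCat.of R M) (FGModuleCat.of R N) n
      ((factorsProjective R M N).mkQ f) = 0 := hf
  change stableSyzygy R _ _ (iterStableSyzygy R (FGModuleCat.of R M) (FGModuleCat.of R N) n
      ((factorsProjective R M N).mkQ f)) = 0
  rw [h, map_zero]

/-- `V(M, N)`, the union of the ascending chain of the `V_n(M, N)`. -/
noncomputable def VUnion : Submodule R (M →ₗ[R] N) where
  carrier := {f | ∃ n : ℕ, f ∈ V R M N n}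
  zero_mem' := ⟨0, Submodule.zero_mem _⟩
  add_mem' := by
    rintro f g ⟨m, hf⟩ ⟨n, hg⟩
    exact ⟨max m n, Submodule.add_mem _ (V_mono R M N (le_max_left m n) hf)
      (V_mono R M N (le_max_right m n) hg)⟩
  smul_mem' := by
    rintro r f ⟨n, hf⟩
    exact ⟨n, Submodule.smul_mem _ r hf⟩

end Iterate

section Xi

open IsLocalRing

variable (R : Type u) [CommRing R] [IsLocalRing R]

/-- An `R`-submodule of `Hom_R(M, k)`, with `k` the residue field of `R`, is a `k`-subspace. -/
def residueSubspace {M : Type u} [AddCommGroup M] [Module R M]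
    (W : Submodule R (M →ₗ[R] ResidueField R)) :
    Submodule (ResidueField R) (M →ₗ[R] ResidueField R) where
  carrier := W
  zero_mem' := W.zero_mem
  add_mem' := W.add_mem
  smul_mem' := by
    intro c f hf
    obtain ⟨r, rfl⟩ := residue_surjective c
    have h : residue R r • f = r • f := by
      ext x
      simp [Algebra.smul_def]
    rw [h]
    exact W.smul_mem r hf

variable [IsNoetherianRing R]

/-- The `n`-th approximated `ξ`-invariant `ξ_R(n, M) = dim_k V_n(M, k)`. -/
noncomputable def xiApprox (n : ℕ) (M : Type u) [AddCommGroup M] [Module R M]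
    [Module.Finite R M] : ℕ :=
  Module.finrank (ResidueField R) (residueSubspace R (V R M (ResidueField R) n))

/-- Martsinkovsky's `ξ`-invariant `ξ_R(M) = dim_k V(M, k)`. -/
noncomputable def xi (M : Type u) [AddCommGroup M] [Module R M] [Module.Finite R M] : ℕ :=
  Module.finrank (ResidueField R) (residueSubspace R (VUnion R M (ResidueField R)))

end Xi

end StableModule

namespace CategoryTheory

open Abelian

universe w v u

variable {C : Type u} [Category.{v} C] [Abelian C] [HasExt.{w} C]

/-- The morphism `f : X ⟶ Y` induces the zero map `Ext^n(Y, -) → Ext^n(X, -)`. -/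
def ExtVanishes {X Y : C} (f : X ⟶ Y) (n : ℕ) : Prop :=
  ∀ (Z : C) (e : Ext Y Z n), (Ext.mk₀ f).comp e (zero_add n) = 0

namespace ExtVanishes

theorem comp_left {X Y Z : C} {f : X ⟶ Y} {n : ℕ} (hf : ExtVanishes f n) (g : Z ⟶ X) :
    ExtVanishes (g ≫ f) n := fun W e => by
  rw [← Ext.mk₀_comp_mk₀_assoc, hf, Ext.comp_zero]

theorem comp_right {X Y Z : C} {f : X ⟶ Y} {n : ℕ} (hf : ExtVanishes f n) (g : Y ⟶ Z) :
    ExtVanishes (f ≫ g) n := fun W e => by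
  rw [← Ext.mk₀_comp_mk₀_assoc, hf]

theorem of_projective {X Y : C} [Projective Y] (f : X ⟶ Y) (n : ℕ) : ExtVanishes f (n + 1) :=
  fun Z e => by rw [Ext.eq_zero_of_projective e, Ext.comp_zero]

/-- Dimension shifting: for a morphism of short exact sequences whose source has a projective
middle term. -/
theorem shift {S T : ShortComplex C} (hS : S.ShortExact) (hT : T.ShortExact) (φ : S ⟶ T)
    [Projective S.X₂] {n : ℕ} (h : ExtVanishes φ.τ₃ (n + 2)) : ExtVanishes φ.τ₁ (n + 1) := by
  intro Z e
  have h1 : hS.extClass.comp ((Ext.mk₀ φ.τ₁).comp e (zero_add _)) (by lia : 1 + (n + 1) = n + 2)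
      = 0 := by
    rw [← Ext.comp_assoc_of_second_deg_zero, ShortComplex.ShortExact.extClass_naturality hS hT,
      Ext.comp_assoc _ _ _ (zero_add 1) (by lia : 1 + (n + 1) = n + 2) (by lia), h]
  obtain ⟨y, hy⟩ := Ext.contravariant_sequence_exact₁ hS _ _ _ h1
  rw [← hy, Ext.eq_zero_of_projective y, Ext.comp_zero]

/-- The connecting homomorphism turns vanishing on the outer left and the middle terms of two
composable morphisms of short exact sequences into vanishing of the composite on the right. -/
theorem comp_τ₃ {S T U : ShortComplex C} (hT : T.ShortExact)
    (hS : S.ShortExact) (φ : S ⟶ T) (ψ : T ⟶ U) {n : ℕ} (h₁ : ExtVanishes φ.τ₁ n)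
    (h₂ : ExtVanishes ψ.τ₂ (n + 1)) : ExtVanishes (φ.τ₃ ≫ ψ.τ₃) (n + 1) := by
  intro Z e
  have h : (Ext.mk₀ T.g).comp ((Ext.mk₀ ψ.τ₃).comp e (zero_add _)) (zero_add _) = 0 := by
    rw [Ext.mk₀_comp_mk₀_assoc, ← ψ.comm₂₃, ← Ext.mk₀_comp_mk₀_assoc, h₂]
  obtain ⟨b, hb⟩ := Ext.contravariant_sequence_exact₃ hT _ _ h (by lia : 1 + n = n + 1)
  rw [← Ext.mk₀_comp_mk₀_assoc, ← hb,
    ← Ext.comp_assoc _ _ _ (zero_add 1) (by lia : 1 + n = n + 1) (by lia),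
    ← ShortComplex.ShortExact.extClass_naturality hS hT, Ext.comp_assoc_of_second_deg_zero, h₁,
    Ext.comp_zero]

theorem exists_lift {X : C} {S : ShortComplex C} (hS : S.ShortExact) {f : X ⟶ S.X₃}
    (hf : ExtVanishes f 1) : ∃ g : X ⟶ S.X₂, g ≫ S.g = f := by
  obtain ⟨y, hy⟩ := Ext.covariant_sequence_exact₃ _ hS (Ext.mk₀ f) (zero_add 1) (hf _ _)
  obtain ⟨g, rfl⟩ := Ext.addEquiv₀.symm.surjective y
  refine ⟨g, Ext.addEquiv₀.symm.injective ?_⟩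
  simpa using hy

end ExtVanishes

end CategoryTheory

namespace StableModule

open CategoryTheory Abelian

universe u

variable {R : Type u} [CommRing R]

section
variable {M N : Type u} [AddCommGroup M] [Module R M] [Module.Finite R M]
  [AddCommGroup N] [Module R N] [Module.Finite R N]

variable (R M) in
/-- The short exact sequence `0 → Ω M → F → M → 0`. -/
noncomputable def syzygyComplex : ShortComplex (ModuleCat.{u} R) :=
  ShortComplex.mk (ModuleCat.ofHom (syzygyIncl R M)) (ModuleCat.ofHom (cover R M)) (by
    ext x; exact cover_syzygyIncl R x)

theorem syzygyComplex_shortExact : (syzygyComplex R M).ShortExact where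
  exact := (ShortComplex.ShortExact.moduleCat_exact_iff_function_exact _).2 fun x =>
    ⟨fun h => ⟨⟨x, h⟩, rfl⟩, by rintro ⟨y, rfl⟩; exact cover_syzygyIncl R y⟩
  mono_f := (ModuleCat.mono_iff_injective _).2 (syzygyIncl_injective R)
  epi_g := (ModuleCat.epi_iff_surjective _).2 (cover_surjective R (M := M))

instance : Projective (syzygyComplex R M).X₂ :=
  inferInstanceAs (Projective (ModuleCat.of R (Fin (coverRank R M) → R)))

theorem IsSyzygyMap.extVanishes {f : M →ₗ[R] N} {g : Syzygy R M →ₗ[R] Syzygy R N}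
    (h : IsSyzygyMap R f g) {n : ℕ} (hf : ExtVanishes (ModuleCat.ofHom f) (n + 2)) :
    ExtVanishes (ModuleCat.ofHom g) (n + 1) := by
  obtain ⟨F, hF, hg⟩ := h
  let φ : syzygyComplex R M ⟶ syzygyComplex R N :=
    { τ₁ := ModuleCat.ofHom g
      τ₂ := ModuleCat.ofHom F
      τ₃ := ModuleCat.ofHom f
      comm₁₂ := ModuleCat.hom_ext hg
      comm₂₃ := ModuleCat.hom_ext hF }
  exact ExtVanishes.shift (syzygyComplex_shortExact (M := M)) (syzygyComplex_shortExact (M := N)) φ hf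

omit [Module.Finite R M] in
theorem mem_factorsProjective_of_extVanishes {f : M →ₗ[R] N}
    (hf : ExtVanishes (ModuleCat.ofHom f) 1) : f ∈ factorsProjective R M N := by
  obtain ⟨g, hg⟩ := ExtVanishes.exists_lift (S := syzygyComplex R N) syzygyComplex_shortExact hf
  exact ⟨Fin (coverRank R N) → R, inferInstance, inferInstance, inferInstance, g.hom, cover R N,
    (congrArg ModuleCat.Hom.hom hg).symm⟩

end

theorem exists_iterStableSyzygy_eq_mkQ [IsNoetherianRing R] {M N : FGModuleCat.{u} R}
    (f : M →ₗ[R] N) (n : ℕ) {i : ℕ} (hf : ExtVanishes (ModuleCat.ofHom f) (i + n + 1)) :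
    ∃ g : iterSyzygy R n M →ₗ[R] iterSyzygy R n N,
      iterStableSyzygy R M N n ((factorsProjective R M N).mkQ f) =
        (factorsProjective R _ _).mkQ g ∧ ExtVanishes (ModuleCat.ofHom g) (i + 1) := by
  induction n generalizing i with
  | zero => exact ⟨f, rfl, hf⟩
  | succ n ih =>
    obtain ⟨g, hg, hv⟩ := ih (i := i + 1) (by convert hf using 1; lia)
    refine ⟨(exists_isSyzygyMap R g).choose, ?_,
      (exists_isSyzygyMap R g).choose_spec.extVanishes hv⟩
    exact congrArg (stableSyzygy R (iterSyzygy R n M) (iterSyzygy R n N)) hg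

theorem mem_V_of_extVanishes [IsNoetherianRing R] {M N : Type u} [AddCommGroup M] [Module R M]
    [Module.Finite R M] [AddCommGroup N] [Module R N] [Module.Finite R N] {f : M →ₗ[R] N} {n : ℕ}
    (hf : ExtVanishes (ModuleCat.ofHom f) (n + 1)) : f ∈ V R M N n := by
  obtain ⟨g, hg, hv⟩ := exists_iterStableSyzygy_eq_mkQ (M := FGModuleCat.of R M)
    (N := FGModuleCat.of R N) f n (i := 0) (by convert hf using 1; lia)
  refine hg.trans ((Submodule.Quotient.mk_eq_zero _).2 (mem_factorsProjective_of_extVanishes hv))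


/-- Multiplication by `r` as a map `R ⧸ I → R ⧸ J`. -/
def quotientMul (r : R) (I J : Ideal R) (h : ∀ a ∈ I, r * a ∈ J) : (R ⧸ I) →ₗ[R] R ⧸ J :=
  Submodule.mapQ I J (LinearMap.mulLeft R r) h

/-- The quotient map `R ⧸ I → R ⧸ J` for `I ≤ J`. -/
abbrev quotientMap {I J : Ideal R} (h : I ≤ J) : (R ⧸ I) →ₗ[R] R ⧸ J :=
  quotientMul 1 I J fun a ha => by simpa using h ha

/-- The ideal `(J : x)`. -/
def colonElem (J : Ideal R) (x : R) : Ideal R := Submodule.comap (LinearMap.mulLeft R x) J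

theorem mem_colonElem {J : Ideal R} {x a : R} : a ∈ colonElem J x ↔ x * a ∈ J := Iff.rfl

theorem exists_colonElem_pow_stable [IsNoetherianRing R] (J : Ideal R) (x : R) :
    ∃ c, ∀ m, c ≤ m → colonElem J (x ^ c) = colonElem J (x ^ m) :=
  monotone_stabilizes_iff_noetherian.2 inferInstance
    ⟨fun m => colonElem J (x ^ m), monotone_nat_of_le_succ fun n a ha => by
      rw [mem_colonElem, pow_succ', mul_assoc]
      exact J.mul_mem_left x ha⟩

/-- The complex `R ⧸ (J : x) → R ⧸ J → R ⧸ (J + (x))`, whose first map is multiplication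
by `x`. -/
def colonComplex (J : Ideal R) (x : R) : ShortComplex (ModuleCat.{u} R) :=
  ShortComplex.mk (ModuleCat.ofHom (quotientMul x (colonElem J x) J fun _ h => h))
    (ModuleCat.ofHom (quotientMap (le_sup_left : J ≤ J ⊔ Ideal.span {x}))) (by
      refine ModuleCat.hom_ext (LinearMap.ext fun a => ?_)
      obtain ⟨a, rfl⟩ := Submodule.Quotient.mk_surjective _ a
      refine (Submodule.Quotient.mk_eq_zero _).2 ?_
      simp only [LinearMap.mulLeft_apply, one_mul]
      exact Ideal.mem_sup_right (Ideal.mul_mem_right _ _ (Ideal.mem_span_singleton_self x)))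

theorem colonComplex_shortExact (J : Ideal R) (x : R) : (colonComplex J x).ShortExact where
  exact := (ShortComplex.ShortExact.moduleCat_exact_iff_function_exact _).2 fun b => by
    obtain ⟨b, rfl⟩ := Submodule.Quotient.mk_surjective _ b
    refine ⟨fun h => ?_, ?_⟩
    · have h' := (Submodule.Quotient.mk_eq_zero _).1 h
      rw [LinearMap.mulLeft_apply, one_mul] at h'
      obtain ⟨j, hj, y, hy, rfl⟩ := Submodule.mem_sup.1 h'
      obtain ⟨z, rfl⟩ := Ideal.mem_span_singleton'.1 hy
      refine ⟨Submodule.Quotient.mk z, (Submodule.Quotient.eq _).2 ?_⟩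
      convert J.neg_mem hj using 1
      simp [mul_comm]
    · rintro ⟨a, ha⟩
      obtain ⟨a, rfl⟩ := Submodule.Quotient.mk_surjective _ a
      rw [← ha]
      exact congrArg (fun f => f.hom (Submodule.Quotient.mk a)) (colonComplex J x).zero
  mono_f := (ModuleCat.mono_iff_injective _).2 ((injective_iff_map_eq_zero _).2 fun a ha => by
    obtain ⟨a, rfl⟩ := Submodule.Quotient.mk_surjective _ a
    exact (Submodule.Quotient.mk_eq_zero (colonElem J x)).2
      ((Submodule.Quotient.mk_eq_zero J).1 ha))
  epi_g := (ModuleCat.epi_iff_surjective _).2 fun b => by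
    obtain ⟨b, rfl⟩ := Submodule.Quotient.mk_surjective _ b
    exact ⟨Submodule.Quotient.mk b, congrArg Submodule.Quotient.mk (one_mul b)⟩

/-- For `I ≤ J`, the morphism from the complex of `I` and `y * x` to that of `J` and `x`: it is
multiplication by `y` on the first terms and the quotient maps on the other ones. -/
def colonComplexMap {I J : Ideal R} (h : I ≤ J) (x y : R) :
    colonComplex I (y * x) ⟶ colonComplex J x where
  τ₁ := ModuleCat.ofHom (quotientMul y _ _ fun a ha => by
    rw [mem_colonElem] at ha ⊢
    convert h ha using 1; ring)
  τ₂ := ModuleCat.ofHom (quotientMap h)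
  τ₃ := ModuleCat.ofHom (quotientMap (sup_le_sup h (Ideal.span_singleton_le_span_singleton.2
    (Dvd.intro_left y rfl))))
  comm₁₂ := by
    refine ModuleCat.hom_ext (LinearMap.ext fun a => ?_)
    obtain ⟨a, rfl⟩ := Submodule.Quotient.mk_surjective _ a
    exact congrArg Submodule.Quotient.mk (show x * (y * a) = 1 * (y * x * a) by ring)
  comm₂₃ := by
    refine ModuleCat.hom_ext (LinearMap.ext fun a => ?_)
    obtain ⟨a, rfl⟩ := Submodule.Quotient.mk_surjective _ a
    rfl

/-- The ideals generated by powers of the entries of a list. -/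
def IsPowerIdeal : List R → Ideal R → Prop
  | [], I => I = ⊥
  | x :: l, I => ∃ (J : Ideal R) (m : ℕ), IsPowerIdeal l J ∧ I = J ⊔ Ideal.span {x ^ m}

theorem IsPowerIdeal.exists_pow_mem {l : List R} {I : Ideal R} (h : IsPowerIdeal l I) {x : R}
    (hx : x ∈ l) : ∃ m : ℕ, x ^ m ∈ I := by
  induction l generalizing I with
  | nil => simp at hx
  | cons y l ih =>
    obtain ⟨J, m, hJ, rfl⟩ := h
    rcases List.mem_cons.1 hx with rfl | hx
    · exact ⟨m, Ideal.mem_sup_right (Ideal.mem_span_singleton_self _)⟩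
    · obtain ⟨m', hm'⟩ := ih hJ hx
      exact ⟨m', Ideal.mem_sup_left hm'⟩

theorem exists_isPowerIdeal_le {l : List R} {I : Ideal R} (h : ∀ x ∈ l, x ∈ I) :
    ∃ J, IsPowerIdeal l J ∧ J ≤ I := by
  induction l with
  | nil => exact ⟨⊥, rfl, bot_le⟩
  | cons y l ih =>
    obtain ⟨J, hJ, hle⟩ := ih fun x hx => h x (List.mem_cons_of_mem _ hx)
    refine ⟨_, ⟨J, 1, hJ, rfl⟩, sup_le hle ?_⟩
    rw [pow_one, Ideal.span_singleton_le_iff_mem]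
    exact h y List.mem_cons_self

/-- Every ideal generated by powers of `r` elements contains a smaller one such that the quotient
map between the residue rings induces zero on `Ext^i` for all `i > r`. -/
theorem IsPowerIdeal.exists_extVanishes [IsNoetherianRing R] {l : List R} {I : Ideal R}
    (hI : IsPowerIdeal l I) : ∃ (J : Ideal R) (h : J ≤ I), IsPowerIdeal l J ∧
      ∀ n, l.length ≤ n → ExtVanishes (ModuleCat.ofHom (quotientMap h)) (n + 1) := by
  induction l generalizing I with
  | nil =>
    obtain rfl : I = ⊥ := hI
    refine ⟨⊥, le_rfl, rfl, fun n _ => ?_⟩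
    have : Module.Projective R (R ⧸ (⊥ : Ideal R)) :=
      Module.Projective.of_equiv (Submodule.quotEquivOfEqBot ⊥ rfl).symm
    exact ExtVanishes.of_projective (C := ModuleCat R) _ n
  | cons x l ih =>
    obtain ⟨J₀, m, hJ₀, rfl⟩ := hI
    obtain ⟨J₁, h₁₀, hJ₁, hv₁⟩ := ih hJ₀
    obtain ⟨J₂, h₂₁, hJ₂, hv₂⟩ := ih hJ₁
    obtain ⟨c, hc⟩ := exists_colonElem_pow_stable J₂ x
    let φ : colonComplex J₂ (x ^ c * (1 * x ^ m)) ⟶ colonComplex J₁ (1 * x ^ m) :=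
      colonComplexMap h₂₁ (1 * x ^ m) (x ^ c)
    let ψ : colonComplex J₁ (1 * x ^ m) ⟶ colonComplex J₀ (x ^ m) := colonComplexMap h₁₀ (x ^ m) 1
    have hle : J₂ ⊔ Ideal.span {x ^ c * (1 * x ^ m)} ≤ J₀ ⊔ Ideal.span {x ^ m} :=
      sup_le_sup (h₂₁.trans h₁₀) (Ideal.span_singleton_le_span_singleton.2 ⟨x ^ c, by ring⟩)
    have hφψ : φ.τ₃ ≫ ψ.τ₃ = ModuleCat.ofHom (quotientMap hle) := by
      refine ModuleCat.hom_ext (LinearMap.ext fun a => ?_)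
      obtain ⟨a, rfl⟩ := Submodule.Quotient.mk_surjective _ a
      exact congrArg Submodule.Quotient.mk (one_mul _)
    refine ⟨_, hle, ⟨J₂, c + m, hJ₂, by rw [one_mul, pow_add]⟩, fun n hn => ?_⟩
    obtain ⟨n, rfl⟩ : ∃ n', n = n' + 1 := ⟨n - 1, by simp at hn; lia⟩
    simp only [List.length_cons, Nat.add_le_add_iff_right] at hn
    rw [← hφψ]
    refine ExtVanishes.comp_τ₃ (colonComplex_shortExact _ _) (colonComplex_shortExact _ _) φ ψ ?_
      (hv₁ (n + 1) (by lia))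
    have hmul : ∀ a ∈ colonElem J₂ (x ^ c * (1 * x ^ m)), x ^ c * a ∈ J₂ := fun a ha => by
      rw [← mem_colonElem, hc (c + m) (by lia), pow_add]
      rwa [one_mul] at ha
    have hφ : φ.τ₁ = ModuleCat.ofHom (quotientMul (x ^ c) _ J₂ hmul) ≫
        ModuleCat.ofHom (quotientMap h₂₁) ≫
        ModuleCat.ofHom (quotientMap (fun a ha => mem_colonElem.2 (J₁.mul_mem_left _ ha) :
          J₁ ≤ colonElem J₁ (1 * x ^ m))) := by
      refine ModuleCat.hom_ext (LinearMap.ext fun a => ?_)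
      obtain ⟨a, rfl⟩ := Submodule.Quotient.mk_surjective _ a
      exact congrArg Submodule.Quotient.mk (show x ^ c * a = 1 * (1 * (x ^ c * a)) by ring)
    rw [hφ]
    exact ((hv₂ n hn).comp_right _).comp_left _

open IsLocalRing

/-- A system of parameters of a noetherian local ring. -/
theorem exists_list_radical [IsNoetherianRing R] [IsLocalRing R] {d : ℕ} (hd : ringKrullDim R = d) :
    ∃ l : List R, l.length = d ∧ (∀ x ∈ l, x ∈ maximalIdeal R) ∧
      ∀ I : Ideal R, (∀ x ∈ l, x ∈ I.radical) → maximalIdeal R ≤ I.radical := by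
  obtain ⟨s, hs, hc⟩ := (maximalIdeal R).exists_finset_card_eq_height_of_isNoetherianRing
  refine ⟨s.toList, ?_, fun x hx => hs.1.2 (Ideal.subset_span (by simpa using hx)),
    fun I hI => ?_⟩
  · rw [← maximalIdeal_height_eq_ringKrullDim, ← hc] at hd
    simpa using hd
  · rw [Ideal.radical_eq_sInf]
    refine le_sInf fun p hp => hs.2 ⟨hp.2, Ideal.span_le.2 fun x hx => ?_⟩
      (le_maximalIdeal hp.2.ne_top)
    exact (hp.2.radical_le_iff.2 hp.1) (hI x (by simpa using hx))

theorem exists_pow_extVanishes [IsNoetherianRing R] [IsLocalRing R]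
    {d : ℕ} (hd : ringKrullDim R = d) :
    ∃ (n : ℕ) (h : maximalIdeal R ^ n ≤ maximalIdeal R), 0 < n ∧
      ExtVanishes (ModuleCat.ofHom (quotientMap h)) (d + 1) := by
  obtain ⟨l, rfl, hl, hrad⟩ := exists_list_radical hd
  obtain ⟨I, hI, hIm⟩ := exists_isPowerIdeal_le hl
  obtain ⟨J, hJI, hJ, hv⟩ := hI.exists_extVanishes
  obtain ⟨n, hn⟩ := Ideal.exists_pow_le_of_le_radical_of_fg
    (hrad J fun x hx => hJ.exists_pow_mem hx) (IsNoetherian.noetherian _)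
  have hn' : maximalIdeal R ^ (n + 1) ≤ J := (Ideal.pow_le_pow_right n.le_succ).trans hn
  refine ⟨n + 1, Ideal.pow_le_self n.succ_ne_zero, n.succ_pos, ?_⟩
  have h : ModuleCat.ofHom (quotientMap (Ideal.pow_le_self n.succ_ne_zero)) =
      ModuleCat.ofHom (quotientMap hn') ≫ ModuleCat.ofHom (quotientMap hJI) ≫
        ModuleCat.ofHom (quotientMap hIm) := by
    refine ModuleCat.hom_ext (LinearMap.ext fun a => ?_)
    obtain ⟨a, rfl⟩ := Submodule.Quotient.mk_surjective _ a
    exact congrArg Submodule.Quotient.mk (show 1 * a = 1 * (1 * (1 * a)) by ring)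
  rw [h]
  exact ((hv _ le_rfl).comp_right _).comp_left _

variable [IsLocalRing R]

instance finite_hom_residueField (I : Ideal R) :
    Module.Finite (ResidueField R) ((R ⧸ I) →ₗ[R] ResidueField R) := by
  let ev : ((R ⧸ I) →ₗ[R] ResidueField R) →ₗ[ResidueField R] ResidueField R :=
    { toFun := fun f => f (Submodule.Quotient.mk 1)
      map_add' := fun _ _ => rfl
      map_smul' := fun _ _ => rfl }
  refine Module.Finite.of_injective ev ((injective_iff_map_eq_zero _).2 fun f hf => ?_)
  refine LinearMap.ext fun a => ?_
  obtain ⟨a, rfl⟩ := Submodule.Quotient.mk_surjective _ a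
  have : (Submodule.Quotient.mk a : R ⧸ I) = a • Submodule.Quotient.mk 1 := by
    rw [← Submodule.Quotient.mk_smul, smul_eq_mul, mul_one]
  rw [this, map_smul]
  exact (congrArg (a • ·) hf).trans (smul_zero a)

theorem finrank_residueSubspace_ne_zero {I : Ideal R}
    {W : Submodule R ((R ⧸ I) →ₗ[R] ResidueField R)} {f : (R ⧸ I) →ₗ[R] ResidueField R}
    (hf : f ∈ W) (h : f ≠ 0) :
    Module.finrank (ResidueField R) (residueSubspace R W) ≠ 0 := by
  rw [Ne, Submodule.finrank_eq_zero]
  intro h0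
  have : f ∈ residueSubspace R W := hf
  rw [h0, Submodule.mem_bot] at this
  exact h this

end StableModule

theorem proposition4p16 {R : Type*} [CommRing R] [IsNoetherianRing R] [IsLocalRing R]
    (d : ℕ) (hd : ringKrullDim R = d) :
    (∃ n : ℕ, 0 < n ∧
      StableModule.xiApprox R d (R ⧸ IsLocalRing.maximalIdeal R ^ n) ≠ 0) ∧
    (∃ n : ℕ, 0 < n ∧ StableModule.xi R (R ⧸ IsLocalRing.maximalIdeal R ^ n) ≠ 0) := by
  obtain ⟨n, hle, hn, hv⟩ := StableModule.exists_pow_extVanishes hd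
  let f : (R ⧸ IsLocalRing.maximalIdeal R ^ n) →ₗ[R] IsLocalRing.ResidueField R :=
    StableModule.quotientMap hle
  have hV : f ∈ StableModule.V R _ _ d := StableModule.mem_V_of_extVanishes hv
  have hne : f ≠ 0 := fun h => one_ne_zero (α := IsLocalRing.ResidueField R)
    ((congrArg Submodule.Quotient.mk (one_mul 1)).symm.trans
      (LinearMap.congr_fun h (Submodule.Quotient.mk 1)))
  exact ⟨⟨n, hn, StableModule.finrank_residueSubspace_ne_zero hV hne⟩,
    ⟨n, hn, StableModule.finrank_residueSubspace_ne_zero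
      (W := StableModule.VUnion R _ _) ⟨d, hV⟩ hne⟩⟩
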